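/- Let $K$ be a positive integer, $T>0$, $T_{cp}\ge 0$, $\Delta f = 1/T$ and $B = K\Delta f$. Write $\mathrm{sinc}(u)=\sin(\pi u)/(\pi u)$, $\mathrm{sinc}(0)=1$. Let $$w_1(\tau)=\sqrt B\,\mathrm{sinc}(B\tau)\,e^{j\pi(B-\frac1T)\tau},\qquad W_2(t)=\begin{cases}1/\sqrt T,&-T_{cp}\le t<T,\\0,&\text{otherwise.}\end{cases}$$ The CP-OFDM modulator with $K$ sub-carriers maps symbols $S[0],\dots,S[K-1]$ to $$x(t)=W_2(t)\sum_{i=0}^{K-1}S[i]\,e^{j2\pi i\Delta f t}.$$ Its IDFT implementation forms $a[n]=\frac1{\sqrt K}\sum_{i=0}^{K-1}S[i]e^{j2\pi ni/K}$, $n\in\mathbb Z$, filters the impulse train $\sqrt T\sum_{n\in\mathbb Z}a[n]\,\delta(t-n/B)$ with $w_1$, and multiplies the result by $W_2(t)$. Let $M,N$ be positive integers with $MN=K$. Zak-OTFS with parameters $M,N$, periods $\tau_p,\nu_p$ satisfying $\tau_p\nu_p=1$, $M=B\tau_p$, $N=T\nu_p$, and delay-Doppler (DD) transmit pulse shaping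 filter $w_{tx}$ maps information symbols $x[k,l]$, $0\le k<M$, $0\le l<N$, to a signal as follows. They are extended to $\mathbb Z^2$ by $x_{dd}[k,l]=x[k\bmod M,\,l\bmod N]\,e^{j2\pi\lfloor k/M\rfloor l/N}$; then $$F = w_{tx} *_\sigma \sum_{k,l\in\mathbb Z}x_{dd}[k,l]\,\delta(\tau-\tfrac kB)\,\delta(\nu-\tfrac lT),\qquad x(t)=\sqrt{\tau_p}\int_0^{\nu_p}F(t,\nu)\,d\nu,$$ where $(a*_\sigma b)(\tau,\nu)=\iint a(\tau',\nu')\,b(\tau-\tau',\nu-\nu')\,e^{j2\pi\nu'(\tau-\tau')}\,d\tau'd\nu'$ is twisted convolution. Series over impulse trains are understood as limits of symmetric partial sums ($|n|\le P$; respectively $|k|\le P$, $|l|\le Q$ with $P,Q\to\infty$ independently). **Theorem.** For all positive integers $M,N$ with $MN=K$ and all information symbols $x[k,l]$, Zak-OTFS with the DD transmit pulse shaping filter $$w_{tx}(\tau,\nu)=w_1(\tau)\,w_2(\nu)\,e^{j2\pi\nu\tau},\qquad w_2(\nu)=\frac{T+T_{cp}}{\sqrt T}\,\mathrm{sinc}\big((T+T_{cp})\nu\big)\,e^{-j\pi\nu(T-T_{cp})},$$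 is the precoding $S[i]=\frac1{\sqrt M}\sum_{k=0}^{M-1}x_{dd}[k,i]\,e^{-j2\pi ik/(MN)}$ (IDFZT) followed by the CP-OFDM modulator. That is: the series defining $F$ converges at every $(\tau,\nu)$; $F$ is quasi-periodic, $F(\tau+n\tau_p,\nu+m\nu_p)=e^{j2\pi n\nu\tau_p}F(\tau,\nu)$ for $n,m\in\mathbb Z$; $F(t,\cdot)$ is integrable over $[0,\nu_p]$ for every $t$; the Zak-OTFS signal equals $W_2(t)\sum_{i=0}^{K-1}S[i]e^{j2\pi i\Delta f t}$ for every $t\in\mathbb R$ other than the two jump points $t=-T_{cp}$, $t=T$ of the window; and the latter CP-OFDM signal is, for every $t$, the output of the IDFT implementation fed with $S[i]$. Here $w_1(t)=\int_{-\Delta f/2}^{B-\Delta f/2}\frac1{\sqrt B}e^{j2\pi ft}\,df$ has bandwidth $B$, and $w_2(\nu)=\int W_2(t)e^{-j2\pi\nu t}\,dt$ is the Fourier transform of the rectangular window of length $T+T_{cp}$. The periods are exactly $\nu_p=N/T=N\Delta f$ and $\tau_p=1/\nu_p=M/B$. -/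

import Mathlib

open Filter Topology MeasureTheory

namespace ZakOtfs

noncomputable section

/-- The phase `e^{j 2 π θ}`. -/
def phase (θ : ℝ) : ℂ := Complex.exp (2 * (Real.pi : ℂ) * Complex.I * (θ : ℂ))

/-- The normalized sinc of signal processing, `sinc u = sin (π u) / (π u)`, `sinc 0 = 1`. -/
def nsinc (u : ℝ) : ℝ := Real.sinc (Real.pi * u)

/-! ### Discrete signals -/

/-- Quasi-periodic extension `x_dd[k,l] = x[k mod M, l mod N] e^{j 2 π ⌊k/M⌋ l / N}` of the
information symbols `x[k,l]`, `0 ≤ k < M`, `0 ≤ l < N` (other values of `x` are never used). -/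
def xdd (M N : ℕ) (x : ℤ → ℤ → ℂ) (k l : ℤ) : ℂ :=
  x (k % (M : ℤ)) (l % (N : ℤ)) * phase (((k / (M : ℤ) : ℤ) : ℝ) * (l : ℝ) / (N : ℝ))

/-- Inverse discrete frequency Zak transform:
`S[i] = M^{-1/2} ∑_{k=0}^{M-1} c[k,i] e^{-j 2 π i k / (M N)}`. -/
def idfzt (M N : ℕ) (c : ℤ → ℤ → ℂ) (i : ℤ) : ℂ :=
  (1 / (Real.sqrt (M : ℝ) : ℂ)) *
    ∑ k ∈ Finset.range M, c (k : ℤ) i * phase (-((i : ℝ) * (k : ℝ) / ((M : ℝ) * (N : ℝ))))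

/-- Inverse discrete Fourier transform:
`x[n] = K^{-1/2} ∑_{i=0}^{K-1} S[i] e^{j 2 π n i / K}`. -/
def idft (K : ℕ) (S : ℤ → ℂ) (n : ℤ) : ℂ :=
  (1 / (Real.sqrt (K : ℝ) : ℂ)) *
    ∑ i ∈ Finset.range K, S (i : ℤ) * phase ((n : ℝ) * (i : ℝ) / (K : ℝ))

/-! ### Pulses and windows -/

/-- The rectangular window: `1 / √T` on `[-T_cp, T)`, zero elsewhere. -/
def window (T Tcp : ℝ) (t : ℝ) : ℂ :=
  Set.indicator (Set.Ico (-Tcp) T) (fun _ => 1 / (Real.sqrt T : ℂ)) t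

/-- `w₁(τ) = √B sinc(B τ) e^{j π (B - 1/T) τ}`. -/
def w1 (B T : ℝ) (τ : ℝ) : ℂ :=
  (Real.sqrt B : ℂ) * (nsinc (B * τ) : ℂ) * phase ((B - 1 / T) * τ / 2)

/-- `w₂(ν) = (T + T_cp) / √T · sinc((T + T_cp) ν) e^{-j π ν (T - T_cp)}`. -/
def w2 (T Tcp : ℝ) (ν : ℝ) : ℂ :=
  (((T + Tcp) / Real.sqrt T : ℝ) : ℂ) * (nsinc ((T + Tcp) * ν) : ℂ) *
    phase (-(ν * (T - Tcp) / 2))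

/-- The delay-Doppler transmit filter `w_tx(τ, ν) = w₁(τ) w₂(ν) e^{j 2 π ν τ}`. -/
def wtx (B T Tcp : ℝ) (τ ν : ℝ) : ℂ := w1 B T τ * w2 T Tcp ν * phase (ν * τ)

/-! ### CP-OFDM -/

/-- The CP-OFDM signal `W(t) ∑_{i=0}^{K-1} S[i] e^{j 2 π i Δf t}` with time window `W`. -/
def cpOfdm (K : ℕ) (Δf : ℝ) (W : ℝ → ℂ) (S : ℤ → ℂ) (t : ℝ) : ℂ :=
  (∑ i ∈ Finset.range K, S (i : ℤ) * phase ((i : ℝ) * Δf * t)) * W t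

/-- Linear convolution `(h ⋆ μ)(t) = ∫ h(t - s) dμ(s)` of a filter with a measure. -/
def linConv (h : ℝ → ℂ) (μ : Measure ℝ) (t : ℝ) : ℂ := ∫ s, h (t - s) ∂μ

/-- `y = h ⋆ √T ∑_{n ∈ ℤ} a[n] δ(t - n/B)`. The series converges only conditionally for a sinc
filter, and is the limit of its symmetric partial sums. -/
def IsFilteredTrain (B T : ℝ) (h : ℝ → ℂ) (a : ℤ → ℂ) (y : ℝ → ℂ) : Prop :=
  ∀ t : ℝ, Tendsto
    (fun P : ℕ => (Real.sqrt T : ℂ) * ∑ n ∈ Finset.Icc (-(P : ℤ)) (P : ℤ),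
      a n * linConv h (Measure.dirac ((n : ℝ) / B)) t)
    atTop (𝓝 (y t))

/-- `X` is the output of the IDFT based CP-OFDM modulator fed with `S`: IDFT, modulation of an
impulse train of rate `B`, filtering with `h`, time-windowing with `W`. -/
def IsIdftCpOfdm (K : ℕ) (B T : ℝ) (h W : ℝ → ℂ) (S : ℤ → ℂ) (X : ℝ → ℂ) : Prop :=
  ∃ y : ℝ → ℂ, IsFilteredTrain B T h (idft K S) y ∧ ∀ t, X t = W t * y t

/-! ### Zak-OTFS -/

/-- Period parameters of Zak-OTFS on the information lattice `(1/B)ℤ × (1/T)ℤ`: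
`τ_p ν_p = 1`, `M = B τ_p`, `N = T ν_p`. -/
def IsZakPeriods (M N : ℕ) (B T τp νp : ℝ) : Prop :=
  τp * νp = 1 ∧ (M : ℝ) = B * τp ∧ (N : ℝ) = T * νp

/-- Twisted convolution
`(w *_σ μ)(τ, ν) = ∬ w(τ - τ', ν - ν') e^{j 2 π (ν - ν') τ'} dμ(τ', ν')`
of a delay-Doppler filter with a measure on the delay-Doppler plane; this is the usual
`∬ w(τ', ν') x(τ - τ', ν - ν') e^{j 2 π ν' (τ - τ')} dτ' dν'` after a change of variables. -/
def twistedConv (w : ℝ → ℝ → ℂ) (μ : Measure (ℝ × ℝ)) (τ ν : ℝ) : ℂ :=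
  ∫ p, w (τ - p.1) (ν - p.2) * phase ((ν - p.2) * p.1) ∂μ

/-- `F = w *_σ ∑_{k,l ∈ ℤ} c[k,l] δ(τ - k/B) δ(ν - l/T)`, the limit of the symmetric rectangular
partial sums (`|k| ≤ P`, `|l| ≤ Q`, with `P` and `Q` tending to infinity independently). -/
def IsFilteredDD (B T : ℝ) (w : ℝ → ℝ → ℂ) (c : ℤ → ℤ → ℂ) (F : ℝ → ℝ → ℂ) : Prop :=
  ∀ τ ν : ℝ, Tendsto
    (fun PQ : ℕ × ℕ =>
      ∑ k ∈ Finset.Icc (-(PQ.1 : ℤ)) (PQ.1 : ℤ), ∑ l ∈ Finset.Icc (-(PQ.2 : ℤ)) (PQ.2 : ℤ),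
        c k l * twistedConv w (Measure.dirac ((k : ℝ) / B, (l : ℝ) / T)) τ ν)
    (atTop ×ˢ atTop) (𝓝 (F τ ν))

/-- Quasi-periodicity on the delay-Doppler plane:
`F(τ + n τ_p, ν + m ν_p) = e^{j 2 π n ν τ_p} F(τ, ν)`. -/
def IsQuasiPeriodic (τp νp : ℝ) (F : ℝ → ℝ → ℂ) : Prop :=
  ∀ (n m : ℤ) (τ ν : ℝ),
    F (τ + (n : ℝ) * τp) (ν + (m : ℝ) * νp) = phase ((n : ℝ) * ν * τp) * F τ ν

/-- Inverse Zak transform `√τ_p ∫_0^{ν_p} F(t, ν) dν`. -/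
def invZak (τp νp : ℝ) (F : ℝ → ℝ → ℂ) (t : ℝ) : ℂ :=
  (Real.sqrt τp : ℂ) * ∫ ν in (0 : ℝ)..νp, F t ν

/-- `X` is the Zak-OTFS transmit signal carrying the information symbols `x`, with periods
`τ_p, ν_p` and delay-Doppler pulse shaping filter `w`: the inverse Zak transform of
`F = w *_σ x_dd`, which is a genuine quasi-periodic function, integrable over a Doppler period. -/
def IsZakOtfs (M N : ℕ) (B T τp νp : ℝ) (w : ℝ → ℝ → ℂ) (x : ℤ → ℤ → ℂ) (X : ℝ → ℂ) : Prop :=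
  IsZakPeriods M N B T τp νp ∧
  ∃ F : ℝ → ℝ → ℂ,
    IsFilteredDD B T w (xdd M N x) F ∧
    IsQuasiPeriodic τp νp F ∧
    (∀ t, IntervalIntegrable (F t) volume 0 νp) ∧
    ∀ t, X t = invZak τp νp F t

end

end ZakOtfs

namespace ZakOtfs

/-! ### The phase -/

/-! The filtered delay-Doppler train `F` is the Zak transform, with period `T/N = M/B`, of the
windowed multicarrier signal; inverting the Zak transform then returns that signal.

Two facts separate the double series. The factor `e^{j2πντ}` in `wtx` absorbs the twist, so each
impulse contributes a product of a `w1` term in `k` and a `w2` term in `l`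
(`twistedConv_dirac_wtx`). The discrete Zak transform writes `xdd k l` as a sum over `r < N` of IDFT
samples at `k + rM` times `e^{-j2πrl/N}` (`xdd_eq_sum_idft`). For each `r`, the sum over `k`
interpolates the multicarrier signal at `τ + rT/N` (`tendsto_sum_idft_mul_w1`), and the sum over `l`
periodizes the window (`tendsto_sum_phase_mul_w2`). Writing `n = mN + r` and using the
`T`-periodicity of the subcarriers reassembles the Zak series (`zak_midWindowed`).

Both limits are cases of one Poisson formula for an exponential cut off to an interval
(`tendsto_sum_phase_mul_integral`), proved with the Dirichlet kernel because the series converge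
only conditionally. At a jump it yields the mean of the one-sided values, hence the two excluded
instants. -/

theorem phase_zero : phase 0 = 1 := by simp [phase]

theorem phase_add (a b : ℝ) : phase (a + b) = phase a * phase b := by
  simp only [phase, ← Complex.exp_add]
  push_cast
  ring_nf

theorem phase_int (n : ℤ) : phase n = 1 := by
  rw [phase, Complex.exp_eq_one_iff]
  exact ⟨n, by push_cast; ring⟩

theorem phase_eq_one_iff (a : ℝ) : phase a = 1 ↔ ∃ n : ℤ, a = n := by
  constructor
  · intro h
    rw [phase, Complex.exp_eq_one_iff] at h
    obtain ⟨n, hn⟩ := h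
    refine ⟨n, ?_⟩
    have h2 : (2 * (Real.pi : ℂ) * Complex.I) ≠ 0 := Complex.two_pi_I_ne_zero
    have h3 : (a : ℂ) = (n : ℂ) := by
      apply mul_left_cancel₀ h2
      rw [hn]
      ring
    exact_mod_cast h3
  · rintro ⟨n, rfl⟩
    exact phase_int n

theorem phase_eq_of_sub_int {a b : ℝ} (n : ℤ) (h : a = b + n) : phase a = phase b := by
  rw [h, phase_add, phase_int, mul_one]

theorem phase_ne_zero (a : ℝ) : phase a ≠ 0 := Complex.exp_ne_zero _

theorem phase_nat_mul (n : ℕ) (a : ℝ) : phase (n * a) = phase a ^ n := by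
  rw [phase, phase, ← Complex.exp_nat_mul]
  push_cast
  ring_nf

theorem hasDerivAt_phase_mul (c x : ℝ) :
    HasDerivAt (fun s : ℝ => phase (c * s))
      (2 * (Real.pi : ℂ) * Complex.I * (c : ℂ) * phase (c * x)) x := by
  have h1 : HasDerivAt (fun s : ℝ => ((c * s : ℝ) : ℂ)) (c : ℂ) x := by
    have := ((hasDerivAt_id x).const_mul c).ofReal_comp
    simpa using this
  have h2 := (h1.const_mul (2 * (Real.pi : ℂ) * Complex.I)).cexp
  refine (h2.congr_deriv ?_ : HasDerivAt (fun s : ℝ => phase (c * s)) _ x)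
  unfold phase
  ring

@[fun_prop]
theorem continuous_phase : Continuous phase := by
  unfold phase
  fun_prop

/-! ### The Dirichlet kernel -/

/-- The Dirichlet kernel `∑_{|l| ≤ Q} e^{-j 2 π l s}`. -/
noncomputable def dirichletKernel (Q : ℕ) (s : ℝ) : ℂ :=
  ∑ l ∈ Finset.Icc (-(Q : ℤ)) (Q : ℤ), phase (-((l : ℝ) * s))

@[fun_prop]
theorem continuous_dirichletKernel (Q : ℕ) : Continuous (dirichletKernel Q) := by
  unfold dirichletKernel
  fun_prop

theorem sum_Icc_symm_succ (f : ℤ → ℂ) (Q : ℕ) :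
    ∑ l ∈ Finset.Icc (-((Q + 1 : ℕ) : ℤ)) ((Q + 1 : ℕ) : ℤ), f l =
      f (Q + 1) + (f (-(Q + 1)) + ∑ l ∈ Finset.Icc (-(Q : ℤ)) (Q : ℤ), f l) := by
  have h : Finset.Icc (-((Q + 1 : ℕ) : ℤ)) ((Q + 1 : ℕ) : ℤ) =
      insert ((Q : ℤ) + 1) (insert (-((Q : ℤ) + 1)) (Finset.Icc (-(Q : ℤ)) (Q : ℤ))) := by
    ext l
    simp only [Finset.mem_insert, Finset.mem_Icc]
    omega
  rw [h, Finset.sum_insert, Finset.sum_insert]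
  · simp only [Finset.mem_Icc]
    omega
  · simp only [Finset.mem_insert, Finset.mem_Icc]
    omega

/-- The geometric sum telescopes. The product form stays valid at integers `s`, where the factor `1
- phase (-s)` vanishes. -/
theorem dirichletKernel_mul (Q : ℕ) (s : ℝ) :
    dirichletKernel Q s * (1 - phase (-s)) = phase (Q * s) - phase (-((Q + 1 : ℝ) * s)) := by
  induction Q with
  | zero => simp [dirichletKernel, phase_zero]
  | succ Q ih =>
    have e : dirichletKernel (Q + 1) s = phase (-(((Q : ℝ) + 1) * s)) +
        (phase ((Q + 1 : ℝ) * s) + dirichletKernel Q s) := by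
      rw [dirichletKernel, sum_Icc_symm_succ, ← dirichletKernel]
      push_cast
      ring_nf
    rw [e, add_mul (phase _), add_mul (phase _), ih]
    have h1 : phase ((Q : ℝ) * s) = phase ((Q + 1 : ℝ) * s) * phase (-s) := by
      rw [← phase_add]; ring_nf
    have h2 : phase (-(((Q + 1 : ℕ) + 1 : ℝ) * s)) = phase (-(((Q : ℝ) + 1) * s)) * phase (-s) := by
      rw [← phase_add]; push_cast; ring_nf
    rw [h1, h2]
    push_cast
    ring

theorem dirichletKernel_add_int (Q : ℕ) (s : ℝ) (m : ℤ) :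
    dirichletKernel Q (s + m) = dirichletKernel Q s := by
  refine Finset.sum_congr rfl fun l _ => phase_eq_of_sub_int (-(l * m)) ?_
  push_cast
  ring

theorem dirichletKernel_neg (Q : ℕ) (s : ℝ) :
    dirichletKernel Q (-s) = dirichletKernel Q s := by
  induction Q with
  | zero => simp [dirichletKernel]
  | succ Q ih =>
    rw [dirichletKernel, dirichletKernel, sum_Icc_symm_succ, sum_Icc_symm_succ, ← dirichletKernel,
      ← dirichletKernel, ih]
    push_cast
    ring_nf

theorem integral_phase_int_mul (l : ℤ) (hl : l ≠ 0) :
    ∫ s in (-(1 / 2) : ℝ)..(1 / 2), phase (-((l : ℝ) * s)) = 0 := by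
  have hc : (2 * (Real.pi : ℂ) * Complex.I * (-(l : ℂ))) ≠ 0 :=
    mul_ne_zero Complex.two_pi_I_ne_zero (neg_ne_zero.mpr (by exact_mod_cast hl))
  have := integral_exp_mul_complex (a := -(1 / 2)) (b := 1 / 2) hc
  have e : (fun s : ℝ => phase (-((l : ℝ) * s))) =
      fun s : ℝ => Complex.exp (2 * (Real.pi : ℂ) * Complex.I * (-(l : ℂ)) * s) := by
    funext s
    simp only [phase]
    push_cast
    ring_nf
  rw [e, this, div_eq_zero_iff]
  left
  rw [sub_eq_zero, Complex.exp_eq_exp_iff_exists_int]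
  exact ⟨-l, by push_cast; ring⟩

theorem integral_dirichletKernel (Q : ℕ) :
    ∫ s in (-(1 / 2) : ℝ)..(1 / 2), dirichletKernel Q s = 1 := by
  simp only [dirichletKernel]
  rw [intervalIntegral.integral_finsetSum]
  · rw [Finset.sum_eq_single 0]
    · simp [phase_zero]
      norm_num
    · intro l _ hl
      exact integral_phase_int_mul l hl
    · simp
  · intro l _
    exact (by fun_prop : Continuous _).intervalIntegrable _ _

theorem integral_dirichletKernel_half (Q : ℕ) :
    ∫ s in (0 : ℝ)..(1 / 2), dirichletKernel Q s = 1 / 2 := by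
  have hi : ∀ a b : ℝ, IntervalIntegrable (dirichletKernel Q) volume a b := fun a b =>
    (by fun_prop : Continuous _).intervalIntegrable _ _
  have h1 := intervalIntegral.integral_add_adjacent_intervals (hi (-(1 / 2)) 0) (hi 0 (1 / 2))
  have h2 : ∫ s in (-(1 / 2) : ℝ)..0, dirichletKernel Q s =
      ∫ s in (0 : ℝ)..(1 / 2), dirichletKernel Q s := by
    have := intervalIntegral.integral_comp_neg (a := 0) (b := 1 / 2) (dirichletKernel Q)
    simp only [dirichletKernel_neg, neg_zero] at this
    exact this.symm
  rw [integral_dirichletKernel, h2] at h1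
  linear_combination h1 / 2

/-- Riemann–Lebesgue on an interval. -/
theorem tendsto_integral_phase_mul (h : ℝ → ℂ) (a b : ℝ) :
    Tendsto (fun w : ℝ => ∫ s in a..b, phase (-(s * w)) * h s) (cocompact ℝ) (𝓝 0) := by
  have key : ∀ a b : ℝ, Tendsto (fun w : ℝ => ∫ s in Set.Ioc a b, phase (-(s * w)) * h s)
      (cocompact ℝ) (𝓝 0) := by
    intro a b
    -- No integrability is needed: the integral of a non-integrable function is 0 by convention.
    have := Real.tendsto_integral_exp_smul_cocompact (Set.indicator (Set.Ioc a b) h)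
    refine this.congr fun w => ?_
    rw [← integral_indicator measurableSet_Ioc]
    congr 1
    funext v
    by_cases hv : v ∈ Set.Ioc a b
    · rw [Set.indicator_of_mem hv, Set.indicator_of_mem hv, Circle.smul_def,
        Real.fourierChar_apply, phase, smul_eq_mul]
      push_cast
      ring_nf
    · rw [Set.indicator_of_notMem hv, Set.indicator_of_notMem hv, smul_zero]
  simpa [intervalIntegral] using (key a b).sub (key b a)

/-- The factor `1 - phase (-s)` turns the kernel into two exponentials whose frequencies escape to
infinity, and Riemann–Lebesgue kills both. It is applied below with `h` a quotient by this factor.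
-/
theorem tendsto_integral_dirichletKernel_mul (h : ℝ → ℂ) (a b : ℝ)
    (hh : ContinuousOn h (Set.uIcc a b)) :
    Tendsto (fun Q : ℕ => ∫ s in a..b, (1 - phase (-s)) * h s * dirichletKernel Q s)
      atTop (𝓝 0) := by
  have c1 : Tendsto (fun Q : ℕ => -(Q : ℝ)) atTop (cocompact ℝ) :=
    (tendsto_neg_atTop_atBot.comp tendsto_natCast_atTop_atTop).mono_right atBot_le_cocompact
  have c2 : Tendsto (fun Q : ℕ => (Q : ℝ) + 1) atTop (cocompact ℝ) :=
    (tendsto_atTop_add_const_right _ _ tendsto_natCast_atTop_atTop).mono_right atTop_le_cocompact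
  have := ((tendsto_integral_phase_mul h a b).comp c1).sub
    ((tendsto_integral_phase_mul h a b).comp c2)
  rw [sub_zero] at this
  refine this.congr fun Q => ?_
  simp only [Function.comp]
  rw [← intervalIntegral.integral_sub]
  · refine intervalIntegral.integral_congr fun s _ => ?_
    have := dirichletKernel_mul Q s
    have e1 : phase (-(s * -(Q : ℝ))) = phase (Q * s) := by ring_nf
    have e2 : phase (-(s * ((Q : ℝ) + 1))) = phase (-((Q + 1 : ℝ) * s)) := by ring_nf
    simp only [e1, e2]
    linear_combination -(h s) * this
  · exact ((by fun_prop : Continuous fun s : ℝ => phase (-(s * -(Q : ℝ)))).continuousOn.mul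
      hh).intervalIntegrable
  · exact ((by fun_prop : Continuous fun s : ℝ => phase (-(s * ((Q : ℝ) + 1)))).continuousOn.mul
      hh).intervalIntegrable

/-! ### Dirichlet's theorem near the origin -/

theorem one_sub_phase_neg_ne_zero {s : ℝ} (h0 : s ≠ 0) (h1 : -1 < s) (h2 : s < 1) :
    1 - phase (-s) ≠ 0 := by
  rw [sub_ne_zero, ne_comm, Ne, phase_eq_one_iff]
  rintro ⟨n, hn⟩
  have h3 : (-1 : ℤ) < n := by
    have : (-1 : ℝ) < n := by linarith
    exact_mod_cast this
  have h4 : n < (1 : ℤ) := by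
    have : (n : ℝ) < 1 := by linarith
    exact_mod_cast this
  have : n = 0 := by omega
  subst this
  simp at hn
  exact h0 hn

/-- Up to `1/2` the integral is exactly `1/2`, by evenness and total mass 1. The rest, from `1/2` to
`x`, avoids the integers, so dividing by `1 - phase (-s)` is harmless and its limit is 0. -/
theorem tendsto_integral_dirichletKernel_pos {x : ℝ} (h0 : 0 < x) (h1 : x < 1) :
    Tendsto (fun Q : ℕ => ∫ s in (0 : ℝ)..x, dirichletKernel Q s) atTop (𝓝 (1 / 2)) := by
  have hne : ∀ s ∈ Set.uIcc (1 / 2) x, 1 - phase (-s) ≠ 0 := by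
    intro s hs
    have hs' := Set.mem_uIcc.mp hs
    apply one_sub_phase_neg_ne_zero
    · rintro rfl
      rcases hs' with h | h <;> linarith [h.1, h.2]
    · rcases hs' with h | h <;> linarith [h.1, h.2]
    · rcases hs' with h | h <;> linarith [h.1, h.2]
  have hc : ContinuousOn (fun s : ℝ => (1 - phase (-s))⁻¹) (Set.uIcc (1 / 2) x) :=
    ContinuousOn.inv₀ (by fun_prop) hne
  have := (tendsto_integral_dirichletKernel_mul _ (1 / 2) x hc).const_add (1 / 2)
  rw [add_zero] at this
  refine this.congr fun Q => ?_
  have hi : ∀ a b : ℝ, IntervalIntegrable (dirichletKernel Q) volume a b := fun a b =>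
    (by fun_prop : Continuous _).intervalIntegrable _ _
  rw [← intervalIntegral.integral_add_adjacent_intervals (hi 0 (1 / 2)) (hi (1 / 2) x),
    integral_dirichletKernel_half]
  congr 1
  refine intervalIntegral.integral_congr fun s hs => ?_
  rw [mul_inv_cancel₀ (hne s hs), one_mul]

theorem tendsto_integral_dirichletKernel {x : ℝ} (h0 : -1 < x) (h1 : x < 1) :
    Tendsto (fun Q : ℕ => ∫ s in (0 : ℝ)..x, dirichletKernel Q s) atTop
      (𝓝 ((Real.sign x : ℂ) / 2)) := by
  rcases lt_trichotomy x 0 with h | rfl | h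
  · rw [Real.sign_of_neg h]
    have := (tendsto_integral_dirichletKernel_pos (x := -x) (by linarith) (by linarith)).neg
    push_cast
    rw [neg_div]
    refine this.congr fun Q => ?_
    have := intervalIntegral.integral_comp_neg (a := 0) (b := x) (dirichletKernel Q)
    simp only [dirichletKernel_neg, neg_zero] at this
    rw [this, intervalIntegral.integral_symm, neg_neg]
  · simp
  · rw [Real.sign_of_pos h]
    simpa using tendsto_integral_dirichletKernel_pos h h1

/-- Both `phase (v * s) - 1` and `1 - phase (-s)` vanish at 0, the latter to first order and nowhere
else in `(-1, 1)`. Their quotient, expressed through `dslope`, is therefore continuous across the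
origin. -/
theorem tendsto_integral_phase_sub_one_dirichletKernel (v : ℝ) {a b : ℝ}
    (ha : -1 < a) (ha' : a < 1) (hb : -1 < b) (hb' : b < 1) :
    Tendsto (fun Q : ℕ => ∫ s in a..b, (phase (v * s) - 1) * dirichletKernel Q s)
      atTop (𝓝 0) := by
  set f : ℝ → ℂ := fun s => phase (v * s) with hf
  set q : ℝ → ℂ := fun s => phase (-1 * s) with hq
  have df : ∀ x, DifferentiableAt ℝ f x := fun x => (hasDerivAt_phase_mul v x).differentiableAt
  have dq : ∀ x, DifferentiableAt ℝ q x := fun x => (hasDerivAt_phase_mul (-1) x).differentiableAt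
  have ef : ∀ s : ℝ, (s : ℂ) * dslope f 0 s = phase (v * s) - 1 := by
    intro s
    have := sub_smul_dslope f 0 s
    simpa [hf, phase_zero] using this
  have eq : ∀ s : ℝ, (s : ℂ) * dslope q 0 s = phase (-s) - 1 := by
    intro s
    have := sub_smul_dslope q 0 s
    simpa [hq, phase_zero] using this
  have cf : Continuous (dslope f 0) := by
    rw [← continuousOn_univ, continuousOn_dslope univ_mem]
    exact ⟨fun x _ => (df x).continuousAt.continuousWithinAt, df 0⟩
  have cq : Continuous (dslope q 0) := by
    rw [← continuousOn_univ, continuousOn_dslope univ_mem]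
    exact ⟨fun x _ => (dq x).continuousAt.continuousWithinAt, dq 0⟩
  have hne : ∀ s ∈ Set.uIcc a b, dslope q 0 s ≠ 0 := by
    intro s hs
    by_cases h0 : s = 0
    · subst h0
      rw [dslope_same, (hasDerivAt_phase_mul (-1) 0).deriv]
      exact mul_ne_zero (mul_ne_zero Complex.two_pi_I_ne_zero (by norm_num)) (phase_ne_zero _)
    · intro h
      have h3 := eq s
      rw [h, mul_zero] at h3
      have hs' := Set.mem_uIcc.mp hs
      refine one_sub_phase_neg_ne_zero h0 ?_ ?_ (by linear_combination h3)
      · rcases hs' with h | h <;> linarith [h.1, h.2]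
      · rcases hs' with h | h <;> linarith [h.1, h.2]
  have hc : ContinuousOn (fun s : ℝ => -(dslope f 0 s / dslope q 0 s)) (Set.uIcc a b) :=
    (cf.continuousOn.div cq.continuousOn hne).neg
  refine (tendsto_integral_dirichletKernel_mul _ a b hc).congr fun Q => ?_
  refine intervalIntegral.integral_congr fun s hs => ?_
  congr 1
  have h1 : (1 : ℂ) - phase (-s) = -(s * dslope q 0 s) := by rw [eq]; ring
  rw [h1, ← ef]
  field_simp [hne s hs]

/-- Dirichlet's theorem for a truncated exponential on an interval around the origin. -/
theorem tendsto_integral_phase_dirichletKernel (v : ℝ) {a b : ℝ}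
    (ha : -1 < a) (ha' : a < 1) (hb : -1 < b) (hb' : b < 1) :
    Tendsto (fun Q : ℕ => ∫ s in a..b, phase (v * s) * dirichletKernel Q s)
      atTop (𝓝 (((Real.sign b : ℂ) - Real.sign a) / 2)) := by
  have := (tendsto_integral_phase_sub_one_dirichletKernel v ha ha' hb hb').add
    ((tendsto_integral_dirichletKernel hb hb').sub (tendsto_integral_dirichletKernel ha ha'))
  rw [zero_add, ← sub_div] at this
  refine this.congr fun Q => ?_
  have hi : ∀ a b : ℝ, IntervalIntegrable (dirichletKernel Q) volume a b := fun a b =>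
    (by fun_prop : Continuous _).intervalIntegrable _ _
  rw [intervalIntegral.integral_interval_sub_left (hi _ _) (hi _ _),
    ← intervalIntegral.integral_add]
  · refine intervalIntegral.integral_congr fun s _ => ?_
    ring
  · exact (by fun_prop : Continuous _).intervalIntegrable _ _
  · exact hi _ _

/-- The indicator of the interval from `a` to `b`, with the value `1 / 2` at the end points. -/
noncomputable def boxcar (a b x : ℝ) : ℝ := (Real.sign (b - x) - Real.sign (a - x)) / 2

/-- The half values at the end points make this exact even at `x = b`, so adjacent intervals can be
glued. -/
theorem boxcar_add (a b c x : ℝ) : boxcar a b x + boxcar b c x = boxcar a c x := by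
  unfold boxcar
  ring

theorem boxcar_of_lt {a b x : ℝ} (ha : x < a) (hb : x < b) : boxcar a b x = 0 := by
  rw [boxcar, Real.sign_of_pos (sub_pos.mpr ha), Real.sign_of_pos (sub_pos.mpr hb)]
  ring

theorem boxcar_of_gt {a b x : ℝ} (ha : a < x) (hb : b < x) : boxcar a b x = 0 := by
  rw [boxcar, Real.sign_of_neg (sub_neg.mpr ha), Real.sign_of_neg (sub_neg.mpr hb)]
  ring

theorem boxcar_of_mem {a b x : ℝ} (ha : a < x) (hb : x < b) : boxcar a b x = 1 := by
  rw [boxcar, Real.sign_of_neg (sub_neg.mpr ha), Real.sign_of_pos (sub_pos.mpr hb)]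
  ring

theorem sign_mul_of_pos {c : ℝ} (hc : 0 < c) (x : ℝ) : Real.sign (c * x) = Real.sign x := by
  rcases lt_trichotomy x 0 with h | rfl | h
  · rw [Real.sign_of_neg h, Real.sign_of_neg (mul_neg_of_pos_of_neg hc h)]
  · simp
  · rw [Real.sign_of_pos h, Real.sign_of_pos (mul_pos hc h)]

/-- A boxcar sampled along an arithmetic progression has finite support. -/
theorem finite_support_boxcar_mul (a b x : ℝ) {c : ℝ} (hc : 0 < c) (g : ℤ → ℂ) :
    Function.HasFiniteSupport fun m : ℤ => (boxcar a b (x + m * c) : ℂ) * g m := by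
  refine (Set.finite_Icc ⌊(min a b - x) / c⌋ ⌈(max a b - x) / c⌉).subset fun m hm => ?_
  have hb : boxcar a b (x + m * c) ≠ 0 := by
    intro h
    simp [h] at hm
  constructor
  · by_contra! h
    apply hb
    have h2 : (m : ℝ) < (min a b - x) / c := by linarith [Int.lt_floor_iff.mp h]
    rw [lt_div_iff₀ hc] at h2
    exact boxcar_of_lt (by linarith [min_le_left a b]) (by linarith [min_le_right a b])
  · by_contra! h
    apply hb
    have h2 : (max a b - x) / c < m := by linarith [Int.ceil_lt_iff.mp h]
    rw [div_lt_iff₀ hc] at h2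
    exact boxcar_of_gt (by linarith [le_max_left a b]) (by linarith [le_max_right a b])

theorem summable_boxcar_mul (a b x : ℝ) {c : ℝ} (hc : 0 < c) (g : ℤ → ℂ) :
    Summable fun m : ℤ => (boxcar a b (x + m * c) : ℂ) * g m :=
  summable_of_hasFiniteSupport (finite_support_boxcar_mul a b x hc g)

/-! ### Dirichlet's theorem on arbitrary intervals and Poisson summation -/

theorem summable_boxcar_int_mul (a b : ℝ) (g : ℤ → ℂ) :
    Summable fun m : ℤ => (boxcar a b m : ℂ) * g m := by
  simpa using summable_boxcar_mul a b 0 one_pos g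

/-- Both end points lie within distance 1 of `m`, so only the term at `m` survives; 1-periodicity of
the kernel moves `m` to the origin. -/
theorem tendsto_integral_phase_dirichletKernel_int (v : ℝ) (m : ℤ) {a b : ℝ}
    (ha : (m : ℝ) - 1 < a) (ha' : a < m + 1) (hb : (m : ℝ) - 1 < b) (hb' : b < m + 1) :
    Tendsto (fun Q : ℕ => ∫ s in a..b, phase (v * s) * dirichletKernel Q s)
      atTop (𝓝 (∑' n : ℤ, (boxcar a b n : ℂ) * phase (v * n))) := by
  rw [tsum_eq_single m]
  · have := (tendsto_integral_phase_dirichletKernel v (a := a - m) (b := b - m) (by linarith)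
      (by linarith) (by linarith) (by linarith)).const_mul (phase (v * m))
    have e : (boxcar a b m : ℂ) * phase (v * m) =
        phase (v * m) * (((Real.sign (b - m) : ℂ) - Real.sign (a - m)) / 2) := by
      rw [boxcar]
      push_cast
      ring
    rw [e]
    refine this.congr fun Q => ?_
    rw [← intervalIntegral.integral_const_mul,
      ← intervalIntegral.integral_comp_sub_right
        (fun s => phase (v * m) * (phase (v * s) * dirichletKernel Q s))]
    refine intervalIntegral.integral_congr fun s _ => ?_
    rw [← mul_assoc, ← phase_add, sub_eq_add_neg s, ← Int.cast_neg, dirichletKernel_add_int]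
    push_cast
    ring_nf
  · intro n hn
    rcases lt_or_gt_of_ne hn with h | h
    · have h : (n : ℝ) ≤ m - 1 := by
        have : n ≤ m - 1 := by omega
        exact_mod_cast this
      rw [boxcar_of_lt (by linarith) (by linarith)]
      simp
    · have h : (m : ℝ) + 1 ≤ n := by exact_mod_cast h
      rw [boxcar_of_gt (by linarith) (by linarith)]
      simp

theorem tendsto_integral_phase_dirichletKernel_of_adjacent (v : ℝ) {a b c : ℝ}
    (h1 : Tendsto (fun Q : ℕ => ∫ s in a..b, phase (v * s) * dirichletKernel Q s)
      atTop (𝓝 (∑' n : ℤ, (boxcar a b n : ℂ) * phase (v * n))))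
    (h2 : Tendsto (fun Q : ℕ => ∫ s in b..c, phase (v * s) * dirichletKernel Q s)
      atTop (𝓝 (∑' n : ℤ, (boxcar b c n : ℂ) * phase (v * n)))) :
    Tendsto (fun Q : ℕ => ∫ s in a..c, phase (v * s) * dirichletKernel Q s)
      atTop (𝓝 (∑' n : ℤ, (boxcar a c n : ℂ) * phase (v * n))) := by
  have := h1.add h2
  rw [← (summable_boxcar_int_mul _ _ _).tsum_add (summable_boxcar_int_mul _ _ _)] at this
  simp only [← add_mul, ← Complex.ofReal_add, boxcar_add] at this
  refine this.congr fun Q => ?_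
  exact intervalIntegral.integral_add_adjacent_intervals
    ((by fun_prop : Continuous _).intervalIntegrable _ _)
    ((by fun_prop : Continuous _).intervalIntegrable _ _)

/-- Dirichlet's theorem for a truncated exponential on an arbitrary interval. -/
theorem tendsto_integral_phase_dirichletKernel_tsum (v : ℝ) {a b : ℝ} (hab : a ≤ b) :
    Tendsto (fun Q : ℕ => ∫ s in a..b, phase (v * s) * dirichletKernel Q s)
      atTop (𝓝 (∑' n : ℤ, (boxcar a b n : ℂ) * phase (v * n))) := by
  -- Cutting into `n` equal pieces makes each at most `1/2` long. A piece starting at `x` then lies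
  -- within distance 1 of `⌈x⌉`.
  obtain ⟨n, hn⟩ := exists_nat_gt (2 * (b - a))
  have hn0 : (0 : ℝ) < n := by linarith
  have step : ∀ x y : ℝ, 0 ≤ y → y ≤ 1 / 2 →
      Tendsto (fun Q : ℕ => ∫ s in x..(x + y), phase (v * s) * dirichletKernel Q s)
        atTop (𝓝 (∑' n : ℤ, (boxcar x (x + y) n : ℂ) * phase (v * n))) := by
    intro x y h0 h1
    have h2 := Int.le_ceil x
    have h3 := Int.ceil_lt_add_one x
    exact tendsto_integral_phase_dirichletKernel_int v ⌈x⌉ (by linarith) (by linarith)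
      (by linarith) (by linarith)
  have key : ∀ k : ℕ,
      Tendsto (fun Q : ℕ => ∫ s in a..(a + k * ((b - a) / n)), phase (v * s) * dirichletKernel Q s)
        atTop (𝓝 (∑' m : ℤ, (boxcar a (a + k * ((b - a) / n)) m : ℂ) * phase (v * m))) := by
    intro k
    induction k with
    | zero => simp [boxcar]
    | succ k ih =>
      refine tendsto_integral_phase_dirichletKernel_of_adjacent v ih ?_
      have := step (a + k * ((b - a) / n)) ((b - a) / n) (by apply div_nonneg <;> linarith)
        (by rw [div_le_iff₀ hn0]; linarith)
      have e : a + ((k + 1 : ℕ) : ℝ) * ((b - a) / n) =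
          a + k * ((b - a) / n) + (b - a) / n := by
        push_cast
        ring
      rw [e]
      exact this
  have := key n
  rwa [mul_div_cancel₀ _ hn0.ne', add_sub_cancel] at this

/-- Poisson summation for a truncated exponential: the Fourier series, in the sense of symmetric
partial sums, of the periodization of `s ↦ e^{j 2 π v s}` on the interval from `a` to `b`. -/
theorem tendsto_sum_phase_mul_integral (v β : ℝ) {a b : ℝ} (hab : a ≤ b) :
    Tendsto (fun Q : ℕ => ∑ l ∈ Finset.Icc (-(Q : ℤ)) (Q : ℤ),
      phase (l * β) * ∫ s in a..b, phase ((v - l) * s))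
      atTop (𝓝 (∑' m : ℤ, (boxcar a b (β + m) : ℂ) * phase (v * (β + m)))) := by
  have := (tendsto_integral_phase_dirichletKernel_tsum v
    (sub_le_sub_right hab β)).const_mul (phase (v * β))
  have e : ∑' m : ℤ, (boxcar a b (β + m) : ℂ) * phase (v * (β + m)) =
      phase (v * β) * ∑' n : ℤ, (boxcar (a - β) (b - β) n : ℂ) * phase (v * n) := by
    rw [← tsum_mul_left]
    congr 1
    funext m
    rw [mul_add, phase_add, boxcar, boxcar, sub_sub, sub_sub]
    ring
  rw [e]
  refine this.congr fun Q => ?_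
  -- Translation by `β` turns the kernel into `∑ phase (l * β) * phase (-(l * s))`, and the sample
  -- points `β + m` into integers.
  rw [← intervalIntegral.integral_const_mul,
    ← intervalIntegral.integral_comp_sub_right
      (fun s => phase (v * β) * (phase (v * s) * dirichletKernel Q s))]
  simp only [← intervalIntegral.integral_const_mul]
  rw [← intervalIntegral.integral_finsetSum]
  · refine intervalIntegral.integral_congr fun s _ => ?_
    simp only [dirichletKernel, Finset.mul_sum]
    refine Finset.sum_congr rfl fun l _ => ?_
    simp only [← phase_add]
    ring_nf
  · intro l _
    exact (by fun_prop : Continuous _).intervalIntegrable _ _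

end ZakOtfs

namespace ZakOtfs

/-! ### The pulses as Fourier integrals -/

theorem phase_sub_phase_neg (y : ℝ) :
    phase (y / 2) - phase (-(y / 2)) = 2 * Complex.I * Complex.sin (Real.pi * y) := by
  rw [Complex.sin, phase, phase]
  have e1 : 2 * (Real.pi : ℂ) * Complex.I * ((y / 2 : ℝ) : ℂ) = Real.pi * y * Complex.I := by
    push_cast; ring
  have e2 : 2 * (Real.pi : ℂ) * Complex.I * ((-(y / 2) : ℝ) : ℂ) = -(Real.pi * y) * Complex.I := by
    push_cast; ring
  rw [e1, e2]
  linear_combination (Complex.exp (Real.pi * y * Complex.I) -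
    Complex.exp (-(Real.pi * y) * Complex.I)) * Complex.I_sq

/-- One closed form serves both pulses and the integral over a Doppler period: the interval length
gives the sinc, its midpoint the phase. -/
theorem integral_phase_mul (a b c : ℝ) :
    ∫ s in a..b, phase (c * s) =
      (b - a : ℝ) * (nsinc ((b - a) * c) : ℂ) * phase ((a + b) * c / 2) := by
  by_cases hc : c = 0
  · simp [hc, phase_zero, nsinc]
  by_cases hab : a = b
  · simp [hab]
  have hab' : b - a ≠ 0 := sub_ne_zero.mpr (Ne.symm hab)
  have hc' : (c : ℂ) ≠ 0 := by exact_mod_cast hc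
  have h2 : 2 * (Real.pi : ℂ) * Complex.I * (c : ℂ) ≠ 0 := mul_ne_zero Complex.two_pi_I_ne_zero hc'
  have e : (fun s : ℝ => phase (c * s)) =
      fun s : ℝ => Complex.exp (2 * (Real.pi : ℂ) * Complex.I * c * s) := by
    funext s
    simp only [phase]
    push_cast
    ring_nf
  have e1 : ∀ s : ℝ, Complex.exp (2 * (Real.pi : ℂ) * Complex.I * c * s) = phase (c * s) :=
    fun s => (congrFun e s).symm
  rw [e, integral_exp_mul_complex h2, e1, e1, div_eq_iff h2]
  have h3 := phase_sub_phase_neg ((b - a) * c)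
  have f1 : phase (c * b) = phase ((a + b) * c / 2) * phase ((b - a) * c / 2) := by
    rw [← phase_add]; ring_nf
  have f2 : phase (c * a) = phase ((a + b) * c / 2) * phase (-((b - a) * c / 2)) := by
    rw [← phase_add]; ring_nf
  have hpi : (Real.pi : ℂ) ≠ 0 := by exact_mod_cast Real.pi_ne_zero
  have hb : ((b - a : ℝ) : ℂ) ≠ 0 := by exact_mod_cast hab'
  rw [f1, f2, ← mul_sub, h3, nsinc, Real.sinc_of_ne_zero
    (mul_ne_zero Real.pi_ne_zero (mul_ne_zero hab' hc))]
  push_cast at hb ⊢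
  field_simp

theorem ofReal_sqrt_mul_self {x : ℝ} (hx : 0 ≤ x) :
    (Real.sqrt x : ℂ) * (Real.sqrt x : ℂ) = (x : ℂ) := by
  exact_mod_cast Real.mul_self_sqrt hx

theorem ofReal_sqrt_ne_zero {x : ℝ} (hx : 0 < x) : (Real.sqrt x : ℂ) ≠ 0 := by
  exact_mod_cast (Real.sqrt_pos.mpr hx).ne'

theorem w1_eq_integral {B : ℝ} (hB : 0 < B) (T t : ℝ) :
    w1 B T t = ∫ f in (-(1 / T / 2))..(B - 1 / T / 2),
      (1 / (Real.sqrt B : ℂ)) * phase (f * t) := by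
  have h1 := ofReal_sqrt_mul_self hB.le
  have h2 := ofReal_sqrt_ne_zero hB
  simp only [mul_comm _ t]
  rw [intervalIntegral.integral_const_mul, integral_phase_mul, w1]
  have e1 : B - 1 / T / 2 - -(1 / T / 2) = B := by ring
  have e2 : (-(1 / T / 2) + (B - 1 / T / 2)) * t / 2 = (B - 1 / T) * t / 2 := by ring
  rw [e1, e2, ← h1]
  field_simp

theorem w2_eq_integral {T Tcp : ℝ} (hT : 0 < T) (hTcp : 0 ≤ Tcp) (ν : ℝ) :
    w2 T Tcp ν = ∫ t : ℝ, window T Tcp t * phase (-(ν * t)) := by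
  have e : (fun t : ℝ => window T Tcp t * phase (-(ν * t))) =
      Set.indicator (Set.Ico (-Tcp) T)
        (fun t => 1 / (Real.sqrt T : ℂ) * phase (-ν * t)) := by
    funext t
    by_cases ht : t ∈ Set.Ico (-Tcp) T
    · simp [window, ht]
    · simp [window, ht]
  rw [e, integral_indicator measurableSet_Ico, integral_Ico_eq_integral_Ioc,
    ← intervalIntegral.integral_of_le (by linarith), intervalIntegral.integral_const_mul,
    integral_phase_mul, w2]
  have e2 : nsinc ((T - -Tcp) * -ν) = nsinc ((T + Tcp) * ν) := by
    rw [nsinc, nsinc, ← Real.sinc_neg]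
    ring_nf
  have e3 : (-Tcp + T) * -ν / 2 = -(ν * (T - Tcp) / 2) := by ring
  rw [e2, e3]
  push_cast
  ring

/-- Interpolation of a complex exponential inside the band of `w₁` from its samples. -/
theorem tendsto_sum_phase_mul_w1 {K i : ℕ} (hi : i < K) {T : ℝ} (hT : 0 < T) (τ : ℝ) :
    Tendsto (fun P : ℕ => ∑ k ∈ Finset.Icc (-(P : ℤ)) (P : ℤ),
      phase (k * (i / K : ℝ)) * w1 (K * (1 / T)) T (τ - k / (K * (1 / T))))
      atTop (𝓝 ((Real.sqrt (K * (1 / T)) : ℂ) * phase (i * (1 / T) * τ))) := by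
  have hK : (0 : ℝ) < K := by exact_mod_cast (by omega : 0 < K)
  have hiK : (i : ℝ) + 1 ≤ K := by exact_mod_cast hi
  -- In units of `B` the band is `(-1/(2K), 1 - 1/(2K))`. The half-subcarrier margin puts `i/K`
  -- strictly inside and its other integer translates strictly outside, so no half value occurs.
  have h := (tendsto_sum_phase_mul_integral (K * (1 / T) * τ) (i / K)
    (a := -(1 / (2 * K))) (b := 1 - 1 / (2 * K)) (by linarith)).const_mul
      (Real.sqrt (K * (1 / T)) : ℂ)
  have hsmall : 1 / (2 * (K : ℝ)) > 0 := by positivity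
  have hhalf : 2 * (1 / (2 * (K : ℝ))) = 1 / K := by field_simp
  have hik : (i : ℝ) / K + 1 / K ≤ 1 := by
    rw [← add_div]
    exact (div_le_one hK).mpr hiK
  have hi0 : 0 ≤ (i : ℝ) / K := by positivity
  rw [tsum_eq_single 0] at h
  · rw [boxcar_of_mem (by push_cast; linarith) (by push_cast; linarith)] at h
    have e : (K * (1 / T) * τ * (i / K + (0 : ℤ)) : ℝ) = i * (1 / T) * τ := by
      push_cast
      field_simp
      ring
    rw [e, Complex.ofReal_one, one_mul] at h
    refine h.congr fun P => ?_
    rw [Finset.mul_sum]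
    refine Finset.sum_congr rfl fun k _ => ?_
    rw [integral_phase_mul, w1]
    have e1 : (1 - 1 / (2 * (K : ℝ)) - -(1 / (2 * K))) = 1 := by ring
    have e2 : (K * (1 / T) * (τ - k / (K * (1 / T))) : ℝ) = K * (1 / T) * τ - k := by
      field_simp
    have e3 : ((K * (1 / T) - 1 / T) * (τ - k / (K * (1 / T))) / 2 : ℝ) =
        (-(1 / (2 * K)) + (1 - 1 / (2 * K))) * (K * (1 / T) * τ - k) / 2 := by
      field_simp
      ring
    rw [e1, e2, e3, one_mul, Complex.ofReal_one]
    ring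
  · intro m hm
    rcases lt_or_gt_of_ne hm with h | h
    · have h : (m : ℝ) ≤ -1 := by exact_mod_cast (by omega : m ≤ -1)
      rw [boxcar_of_lt (by linarith) (by linarith)]
      simp
    · have h : (1 : ℝ) ≤ m := by exact_mod_cast h
      rw [boxcar_of_gt (by linarith) (by linarith)]
      simp

/-- The multicarrier signal `∑_{i=0}^{K-1} S[i] e^{j 2 π i Δf t}`. -/
noncomputable def multicarrier (K : ℕ) (Δf : ℝ) (S : ℤ → ℂ) (t : ℝ) : ℂ :=
  ∑ i ∈ Finset.range K, S (i : ℤ) * phase ((i : ℝ) * Δf * t)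

/-- Filtering the shifted IDFT samples with `w₁` reproduces the multicarrier signal. -/
theorem tendsto_sum_idft_mul_w1 {K : ℕ} (hK : 0 < K) {T : ℝ} (hT : 0 < T) (S : ℤ → ℂ)
    (n : ℤ) (τ : ℝ) :
    Tendsto (fun P : ℕ => ∑ k ∈ Finset.Icc (-(P : ℤ)) (P : ℤ),
      idft K S (k + n) * w1 (K * (1 / T)) T (τ - k / (K * (1 / T))))
      atTop (𝓝 (1 / (Real.sqrt T : ℂ) *
        multicarrier K (1 / T) S (τ + n / (K * (1 / T))))) := by
  have hK' : (0 : ℝ) < K := by exact_mod_cast hK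
  have h := (tendsto_finsetSum (Finset.range K) fun i hi =>
    (tendsto_sum_phase_mul_w1 (Finset.mem_range.mp hi) hT τ).const_mul
      (S i * phase (n * i / K))).const_mul (1 / (Real.sqrt (K : ℝ) : ℂ))
  have e : 1 / (Real.sqrt T : ℂ) * multicarrier K (1 / T) S (τ + n / (K * (1 / T))) =
      1 / (Real.sqrt (K : ℝ) : ℂ) * ∑ i ∈ Finset.range K, S i * phase (n * i / K) *
        ((Real.sqrt (K * (1 / T)) : ℂ) * phase (i * (1 / T) * τ)) := by
    rw [multicarrier, Finset.mul_sum, Finset.mul_sum]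
    refine Finset.sum_congr rfl fun i _ => ?_
    have e1 : phase (i * (1 / T) * (τ + n / (K * (1 / T)))) =
        phase (n * i / K) * phase (i * (1 / T) * τ) := by
      rw [← phase_add]
      congr 1
      field_simp
      ring
    rw [e1, Real.sqrt_mul hK'.le, one_div T, Real.sqrt_inv]
    have := ofReal_sqrt_ne_zero hK'
    have := ofReal_sqrt_ne_zero hT
    push_cast
    field_simp
  rw [e]
  refine h.congr fun P => ?_
  simp only [Finset.mul_sum, idft, Finset.sum_mul]
  rw [Finset.sum_comm]
  refine Finset.sum_congr rfl fun k _ => Finset.sum_congr rfl fun i _ => ?_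
  have e1 : phase (((k + n : ℤ) : ℝ) * i / K) = phase (n * i / K) * phase (k * (i / K : ℝ)) := by
    rw [← phase_add]
    congr 1
    push_cast
    ring
  rw [e1]
  ring

/-- Poisson summation for `w₂`. -/
theorem tendsto_sum_phase_mul_w2 {T Tcp : ℝ} (hT : 0 < T) (hTcp : 0 ≤ Tcp) (β τ ν : ℝ) :
    Tendsto (fun Q : ℕ => ∑ l ∈ Finset.Icc (-(Q : ℤ)) (Q : ℤ),
      phase (-(β * l)) * (w2 T Tcp (ν - l / T) * phase ((ν - l / T) * τ)))
      atTop (𝓝 ((Real.sqrt T : ℂ) * ∑' m : ℤ, (boxcar (-Tcp) T (τ + T * (m + β)) : ℂ) *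
        phase (-(ν * (T * (m + β)))))) := by
  have hab : (τ - T) / T ≤ (τ + Tcp) / T := by gcongr; linarith
  -- Substituting `s = (τ - t)/T` in the Fourier integral of the window gives this interval and the
  -- factor `√T`. The substitution reverses orientation, hence the reindexing `m ↦ -m` below.
  have h := (tendsto_sum_phase_mul_integral (ν * T) (-β) hab).const_mul (Real.sqrt T : ℂ)
  have e : ∑' m : ℤ, (boxcar (-Tcp) T (τ + T * (m + β)) : ℂ) * phase (-(ν * (T * (m + β)))) =
      ∑' m : ℤ, (boxcar ((τ - T) / T) ((τ + Tcp) / T) (-β + m) : ℂ) *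
        phase (ν * T * (-β + m)) := by
    rw [← (Equiv.neg ℤ).tsum_eq]
    congr 1
    funext m
    simp only [Equiv.neg_apply]
    congr 2
    · rw [boxcar, boxcar]
      have e1 : T - (τ + T * (((-m : ℤ) : ℝ) + β)) = -(T * ((τ - T) / T - (-β + m))) := by
        push_cast
        field_simp
        ring
      have e2 : -Tcp - (τ + T * (((-m : ℤ) : ℝ) + β)) = -(T * ((τ + Tcp) / T - (-β + m))) := by
        push_cast
        field_simp
        ring
      rw [e1, e2, Real.sign_neg, Real.sign_neg, sign_mul_of_pos hT, sign_mul_of_pos hT]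
      ring
    · push_cast
      ring
  rw [e]
  refine h.congr fun Q => ?_
  rw [Finset.mul_sum]
  refine Finset.sum_congr rfl fun l _ => ?_
  rw [integral_phase_mul, w2]
  have e1 : (τ + Tcp) / T - (τ - T) / T = (T + Tcp) / T := by ring
  have e2 : (T + Tcp) / T * (ν * T - l) = (T + Tcp) * (ν - l / T) := by field_simp
  have e3 : phase (((τ - T) / T + (τ + Tcp) / T) * (ν * T - l) / 2) =
      phase (-((ν - l / T) * (T - Tcp) / 2)) * phase ((ν - l / T) * τ) := by
    rw [← phase_add]
    congr 1
    field_simp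
    ring
  have e4 : phase ((l : ℝ) * -β) = phase (-(β * l)) := by ring_nf
  have h5 := ofReal_sqrt_ne_zero hT
  have h6 := ofReal_sqrt_mul_self hT.le
  have e7 : (Real.sqrt T : ℂ) * (((T + Tcp) / T : ℝ) : ℂ) =
      (((T + Tcp) / Real.sqrt T : ℝ) : ℂ) := by
    push_cast
    rw [← h6]
    field_simp
  rw [e1, e2, e3, e4, ← e7]
  ring

/-! ### The Zak transform -/

/-- The Zak transform `√p ∑_{n ∈ ℤ} f(τ + n p) e^{-j 2 π n ν p}`. -/
noncomputable def zak (p : ℝ) (f : ℝ → ℂ) (τ ν : ℝ) : ℂ :=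
  (Real.sqrt p : ℂ) * ∑' n : ℤ, f (τ + n * p) * phase (-(n * ν * p))

/-- A delay shift reindexes the series; since `p * q = 1`, a Doppler shift changes each phase by an
integer. -/
theorem isQuasiPeriodic_zak {p q : ℝ} (hpq : p * q = 1) (f : ℝ → ℂ) :
    IsQuasiPeriodic p q (zak p f) := by
  intro n m τ ν
  rw [zak, zak, ← (Equiv.subRight n).tsum_eq, mul_left_comm]
  congr 1
  rw [← tsum_mul_left]
  congr 1
  funext k
  simp only [Equiv.subRight_apply]
  have e1 : τ + n * p + ((k - n : ℤ) : ℝ) * p = τ + k * p := by push_cast; ring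
  have e2 : phase (-(((k - n : ℤ) : ℝ) * (ν + m * q) * p)) =
      phase (n * ν * p) * phase (-(k * ν * p)) := by
    rw [← phase_add]
    refine phase_eq_of_sub_int (-((k - n) * m)) ?_
    push_cast
    linear_combination (-((k : ℝ) - n) * m) * hpq
  rw [e1, e2]
  ring

theorem zak_eq_sum (p : ℝ) (f : ℝ → ℂ) (t : ℝ)
    (hf : Function.HasFiniteSupport fun n : ℤ => f (t + n * p)) (ν : ℝ) :
    zak p f t ν = (Real.sqrt p : ℂ) * ∑ n ∈ hf.toFinset, f (t + n * p) * phase (-(n * ν * p)) := by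
  rw [zak, tsum_eq_sum]
  intro n hn
  have : f (t + n * p) = 0 := by
    by_contra h
    exact hn (hf.mem_toFinset.mpr h)
  rw [this, zero_mul]

theorem intervalIntegrable_zak (p : ℝ) (f : ℝ → ℂ) (t : ℝ)
    (hf : Function.HasFiniteSupport fun n : ℤ => f (t + n * p)) (a b : ℝ) :
    IntervalIntegrable (zak p f t) volume a b := by
  rw [funext (zak_eq_sum p f t hf)]
  exact (by fun_prop : Continuous _).intervalIntegrable _ _

theorem integral_phase_period {p q : ℝ} (hpq : p * q = 1) (n : ℤ) :
    ∫ ν in (0 : ℝ)..q, phase (-(n * ν * p)) = if n = 0 then (q : ℂ) else 0 := by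
  have e : ∀ ν : ℝ, phase (-(n * ν * p)) = phase (-(n * p) * ν) := fun ν => by ring_nf
  simp only [e]
  split_ifs with h
  · simp [h, phase_zero]
  · rw [integral_phase_mul]
    have e1 : (q - 0) * (-(n * p)) = -(n : ℝ) := by linear_combination (-(n : ℝ)) * hpq
    have hn : (n : ℝ) ≠ 0 := by exact_mod_cast h
    have : nsinc (-(n : ℝ)) = 0 := by
      rw [nsinc, mul_neg, Real.sinc_neg, Real.sinc_of_ne_zero (mul_ne_zero Real.pi_ne_zero hn),
        mul_comm, Real.sin_int_mul_pi, zero_div]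
    rw [e1, this]
    simp

/-- Finite support allows termwise integration; orthogonality over a period leaves only `n = 0`,
with weight `√p * √p * q = 1`. -/
theorem invZak_zak {p q : ℝ} (hp : 0 < p) (hpq : p * q = 1) (f : ℝ → ℂ) (t : ℝ)
    (hf : Function.HasFiniteSupport fun n : ℤ => f (t + n * p)) :
    invZak p q (zak p f) t = f t := by
  have hq : (p : ℂ) * q = 1 := by exact_mod_cast hpq
  have hs := ofReal_sqrt_mul_self hp.le
  rw [invZak, funext (zak_eq_sum p f t hf), intervalIntegral.integral_const_mul,
    intervalIntegral.integral_finsetSum]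
  · simp only [intervalIntegral.integral_const_mul, integral_phase_period hpq]
    rw [Finset.sum_eq_single 0]
    · simp only [if_true, Int.cast_zero, zero_mul, add_zero]
      linear_combination (f t * q) * hs + f t * hq
    · intro n _ hn
      simp [hn]
    · intro h0
      have : f (t + (0 : ℤ) * p) = 0 := by
        by_contra h
        exact h0 (hf.mem_toFinset.mpr h)
      rw [this, zero_mul]
  · intro n _
    exact (by fun_prop : Continuous _).intervalIntegrable _ _

/-! ### The discrete transforms -/

theorem sum_range_phase_mul_div {N : ℕ} (hN : 0 < N) (j : ℤ) :
    ∑ r ∈ Finset.range N, phase (r * (j / N : ℝ)) = if (N : ℤ) ∣ j then (N : ℂ) else 0 := by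
  have hN' : (N : ℝ) ≠ 0 := by exact_mod_cast hN.ne'
  simp only [phase_nat_mul]
  split_ifs with h
  · obtain ⟨c, rfl⟩ := h
    have : phase (((N * c : ℤ) : ℝ) / N) = 1 := by
      rw [phase_eq_one_iff]
      exact ⟨c, by push_cast; field_simp⟩
    simp only [this, one_pow, Finset.sum_const, Finset.card_range, nsmul_eq_mul, mul_one]
  · have h1 : phase ((j : ℝ) / N) ≠ 1 := by
      rw [Ne, phase_eq_one_iff]
      rintro ⟨c, hc⟩
      rw [div_eq_iff hN'] at hc
      apply h
      refine ⟨c, ?_⟩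
      have : (j : ℝ) = ((N * c : ℤ) : ℝ) := by rw [hc]; push_cast; ring
      exact_mod_cast this
    have h2 : phase ((j : ℝ) / N) ^ N = 1 := by
      rw [← phase_nat_mul, mul_div_cancel₀ _ hN', phase_int]
    rw [geom_sum_eq h1, h2, sub_self, zero_div]

theorem sum_range_mul_eq (f : ℕ → ℂ) (M N : ℕ) :
    ∑ i ∈ Finset.range (M * N), f i =
      ∑ l ∈ Finset.range N, ∑ j ∈ Finset.range M, f (j * N + l) := by
  rw [Finset.sum_comm]
  induction M with
  | zero => simp
  | succ M ih => rw [Nat.succ_mul, Finset.sum_range_add, ih, Finset.sum_range_succ]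

theorem xdd_add_mul (M N : ℕ) (hM : 0 < M) (x : ℤ → ℤ → ℂ) (k r l : ℤ) :
    xdd M N x (k + r * M) l = xdd M N x k l * phase (r * l / N) := by
  have hM' : (M : ℤ) ≠ 0 := by exact_mod_cast hM.ne'
  rw [xdd, xdd, Int.add_mul_emod_self_right, Int.add_mul_ediv_right _ _ hM', mul_assoc, ← phase_add]
  congr 2
  push_cast
  ring

/-- The IDFT of the IDFZT is the inverse discrete Zak transform. -/
theorem idft_idfzt_xdd {M N : ℕ} (hM : 0 < M) (hN : 0 < N) (x : ℤ → ℤ → ℂ) (n : ℤ) :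
    idft (M * N) (idfzt M N (xdd M N x)) n =
      1 / (Real.sqrt N : ℂ) * ∑ l ∈ Finset.range N, xdd M N x n l := by
  have hM' : (0 : ℝ) < M := by exact_mod_cast hM
  have hN' : (0 : ℝ) < N := by exact_mod_cast hN
  have hMz : (0 : ℤ) < M := by exact_mod_cast hM
  have key : ∀ l ∈ Finset.range N, ∑ j ∈ Finset.range M, ∑ k ∈ Finset.range M,
      xdd M N x (k : ℤ) ((j * N + l : ℕ) : ℤ) *
        phase (((n - k : ℤ) : ℝ) * ((j * N + l : ℕ) : ℝ) / (M * N)) = M * xdd M N x n l := by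
    intro l hl
    have hl := Finset.mem_range.mp hl
    rw [Finset.sum_comm]
    have inner : ∀ k ∈ Finset.range M, ∑ j ∈ Finset.range M,
        xdd M N x (k : ℤ) ((j * N + l : ℕ) : ℤ) *
          phase (((n - k : ℤ) : ℝ) * ((j * N + l : ℕ) : ℝ) / (M * N)) =
        x k l * phase (((n - k : ℤ) : ℝ) * l / (M * N)) *
          (if (M : ℤ) ∣ n - k then (M : ℂ) else 0) := by
      intro k hk
      have hk := Finset.mem_range.mp hk
      rw [← sum_range_phase_mul_div hM, Finset.mul_sum]
      refine Finset.sum_congr rfl fun j _ => ?_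
      -- For `0 ≤ k < M` the quasi-periodic factor is 1, so `j` enters only through the exponential
      -- and its sum detects `M ∣ n - k`.
      have h1 : (k : ℤ) % M = k := Int.emod_eq_of_lt (by omega) (by omega)
      have h2 : (k : ℤ) / M = 0 := Int.ediv_eq_zero_of_lt (by omega) (by omega)
      have h3 : ((j * N + l : ℕ) : ℤ) % N = l := by
        push_cast
        rw [add_comm, Int.add_mul_emod_self_right]
        exact Int.emod_eq_of_lt (by omega) (by omega)
      rw [xdd, h1, h2, h3, mul_assoc (x _ _), mul_assoc (x _ _), ← phase_add, ← phase_add]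
      congr 2
      push_cast
      field_simp
      ring
    rw [Finset.sum_congr rfl inner]
    have hmod := Int.emod_nonneg n hMz.ne'
    have hmod' := Int.emod_lt_of_pos n hMz
    obtain ⟨k₀, hk₀⟩ := Int.eq_ofNat_of_zero_le hmod
    have hdiv := Int.mul_ediv_add_emod n M
    rw [Finset.sum_eq_single k₀]
    · have hd : n - (k₀ : ℤ) = M * (n / M) := by rw [← hk₀]; linarith
      have h3 : (l : ℤ) % N = l := Int.emod_eq_of_lt (by omega) (by omega)
      rw [if_pos ⟨_, hd⟩, xdd, h3, hd, hk₀]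
      -- The leftover phase is exactly the quasi-periodic factor of `xdd` at `n`.
      have e : ((M * (n / M) : ℤ) : ℝ) * l / (M * N) = ((n / M : ℤ) : ℝ) * ((l : ℤ) : ℝ) / N := by
        push_cast
        field_simp
      rw [e]
      ring
    · intro k hk hne
      have hk := Finset.mem_range.mp hk
      rw [if_neg, mul_zero]
      intro hd
      have : n % M = k := by
        rw [((Int.emod_eq_emod_iff_emod_sub_eq_zero.mpr (Int.emod_eq_zero_of_dvd hd)) : n % M = (k : ℤ) % M)]
        exact Int.emod_eq_of_lt (by omega) (by omega)
      omega
    · intro h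
      exact absurd (Finset.mem_range.mpr (by omega)) h
  have step : idft (M * N) (idfzt M N (xdd M N x)) n =
      1 / (Real.sqrt (M * N : ℝ) : ℂ) * (1 / (Real.sqrt M : ℂ) *
        ∑ l ∈ Finset.range N, ∑ j ∈ Finset.range M, ∑ k ∈ Finset.range M,
          xdd M N x (k : ℤ) ((j * N + l : ℕ) : ℤ) *
            phase (((n - k : ℤ) : ℝ) * ((j * N + l : ℕ) : ℝ) / (M * N))) := by
    rw [← sum_range_mul_eq (fun i => ∑ k ∈ Finset.range M, xdd M N x (k : ℤ) (i : ℤ) *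
      phase (((n - k : ℤ) : ℝ) * (i : ℝ) / (M * N))), idft]
    push_cast
    congr 1
    rw [Finset.mul_sum]
    refine Finset.sum_congr rfl fun i _ => ?_
    rw [idfzt, mul_assoc, Finset.sum_mul]
    congr 1
    refine Finset.sum_congr rfl fun k _ => ?_
    rw [mul_assoc, ← phase_add]
    congr 2
    push_cast
    ring
  rw [step, Finset.sum_congr rfl key, ← Finset.mul_sum, Real.sqrt_mul hM'.le]
  have h1 := ofReal_sqrt_mul_self hM'.le
  have h2 := ofReal_sqrt_ne_zero hM'
  have h3 := ofReal_sqrt_ne_zero hN'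
  push_cast at h1 ⊢
  rw [← h1]
  field_simp

/-- The discrete Zak transform recovers the quasi-periodic symbols from the IDFT samples. -/
theorem xdd_eq_sum_idft {M N : ℕ} (hM : 0 < M) (hN : 0 < N) (x : ℤ → ℤ → ℂ) (k l : ℤ) :
    xdd M N x k l = 1 / (Real.sqrt N : ℂ) * ∑ r ∈ Finset.range N,
      idft (M * N) (idfzt M N (xdd M N x)) (k + r * M) * phase (-((r : ℝ) * l / N)) := by
  have hN' : (0 : ℝ) < N := by exact_mod_cast hN
  have hNz : (0 : ℤ) < N := by exact_mod_cast hN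
  have hN0 := hN'.ne'
  simp only [idft_idfzt_xdd hM hN, xdd_add_mul M N hM]
  have h1 : ∑ r ∈ Finset.range N, (1 / (Real.sqrt N : ℂ) * ∑ l' ∈ Finset.range N,
      xdd M N x k l' * phase (((r : ℤ) : ℝ) * ((l' : ℤ) : ℝ) / N)) * phase (-((r : ℝ) * l / N)) =
      1 / (Real.sqrt N : ℂ) * ∑ l' ∈ Finset.range N, xdd M N x k l' *
        (if (N : ℤ) ∣ l' - l then (N : ℂ) else 0) := by
    simp only [← sum_range_phase_mul_div hN, Finset.mul_sum, Finset.sum_mul]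
    rw [Finset.sum_comm]
    refine Finset.sum_congr rfl fun l' _ => Finset.sum_congr rfl fun r _ => ?_
    rw [mul_assoc, mul_assoc (xdd _ _ _ _ _), ← phase_add]
    congr 3
    push_cast
    ring
  rw [h1]
  obtain ⟨l₀, hl₀⟩ := Int.eq_ofNat_of_zero_le (Int.emod_nonneg l hNz.ne')
  have hlt := Int.emod_lt_of_pos l hNz
  have hdiv := Int.mul_ediv_add_emod l N
  rw [Finset.sum_eq_single l₀]
  · have hd : (l₀ : ℤ) - l = N * -(l / N) := by rw [← hl₀]; linarith
    have hs := ofReal_sqrt_mul_self hN'.le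
    have hs0 := ofReal_sqrt_ne_zero hN'
    -- `xdd` is `N`-periodic in its second argument: shifting `l` by `N` changes its phase by the
    -- integer `⌊k/M⌋`.
    have hx : xdd M N x k l₀ = xdd M N x k l := by
      rw [xdd, xdd, ← hl₀, Int.emod_emod]
      congr 1
      refine phase_eq_of_sub_int (-(k / M * (l / N))) ?_
      have : ((l % N : ℤ) : ℝ) = l - N * ((l / N : ℤ) : ℝ) := by
        have : l % N = l - N * (l / N) := by linarith
        rw [this]
        push_cast
        ring
      rw [this]
      push_cast
      field_simp
      ring
    rw [if_pos ⟨_, hd⟩, hx]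
    push_cast at hs
    rw [← hs]
    field_simp
  · intro l' hl' hne
    have hl' := Finset.mem_range.mp hl'
    rw [if_neg, mul_zero]
    intro hd
    have : (l' : ℤ) % N = l % N := (Int.emod_eq_emod_iff_emod_sub_eq_zero.mpr (Int.emod_eq_zero_of_dvd hd))
    rw [Int.emod_eq_of_lt (by omega) (by omega)] at this
    omega
  · intro h
    exact absurd (Finset.mem_range.mpr (by omega)) h

end ZakOtfs

/-! ### The windowed multicarrier signal and its Zak transform -/

namespace ZakOtfs

theorem boxcar_div_sqrt_eq_window {T Tcp t : ℝ} (hT : 0 < T) (hTcp : 0 ≤ Tcp)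
    (h1 : t ≠ -Tcp) (h2 : t ≠ T) :
    (boxcar (-Tcp) T t : ℂ) / (Real.sqrt T : ℂ) = window T Tcp t := by
  rcases lt_or_gt_of_ne h1 with h | h
  · rw [boxcar_of_lt h (by linarith), window, Set.indicator_of_notMem]
    · simp
    · exact fun hm => absurd hm.1 (not_le.mpr h)
  · rcases lt_or_gt_of_ne h2 with h' | h'
    · rw [boxcar_of_mem h h', window, Set.indicator_of_mem (Set.mem_Ico.mpr ⟨h.le, h'⟩)]
      simp
    · rw [boxcar_of_gt h h', window, Set.indicator_of_notMem]
      · simp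
      · exact fun hm => absurd hm.2 (not_lt.mpr h'.le)

theorem multicarrier_add_int_mul (K : ℕ) {T : ℝ} (hT : 0 < T) (S : ℤ → ℂ) (t : ℝ) (m : ℤ) :
    multicarrier K (1 / T) S (t + m * T) = multicarrier K (1 / T) S t := by
  refine Finset.sum_congr rfl fun i _ => ?_
  congr 1
  refine phase_eq_of_sub_int (i * m) ?_
  push_cast
  field_simp

/-- The multicarrier signal under the rectangular window, with mean values at the jumps. -/
noncomputable def midWindowed (K : ℕ) (T Tcp : ℝ) (S : ℤ → ℂ) (t : ℝ) : ℂ :=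
  (boxcar (-Tcp) T t : ℂ) / (Real.sqrt T : ℂ) * multicarrier K (1 / T) S t

theorem hasFiniteSupport_midWindowed (K : ℕ) (T Tcp : ℝ) (S : ℤ → ℂ) (t : ℝ) {p : ℝ}
    (hp : 0 < p) : Function.HasFiniteSupport fun n : ℤ => midWindowed K T Tcp S (t + n * p) := by
  simpa only [midWindowed, div_mul_eq_mul_div, mul_div_assoc] using
    finite_support_boxcar_mul (-Tcp) T t hp
      fun n => multicarrier K (1 / T) S (t + n * p) / (Real.sqrt T : ℂ)

theorem zak_midWindowed {N : ℕ} (hN : 0 < N) (K : ℕ) {T : ℝ} (hT : 0 < T) (Tcp : ℝ)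
    (S : ℤ → ℂ) (τ ν : ℝ) :
    zak (T / N) (midWindowed K T Tcp S) τ ν =
      1 / (Real.sqrt N : ℂ) * ∑ r ∈ Finset.range N,
        (1 / (Real.sqrt T : ℂ) * multicarrier K (1 / T) S (τ + r * (T / N))) *
        ((Real.sqrt T : ℂ) * ∑' m : ℤ, (boxcar (-Tcp) T (τ + T * (m + r / N)) : ℂ) *
          phase (-(ν * (T * (m + r / N))))) := by
  have hN' : (0 : ℝ) < N := by exact_mod_cast hN
  have hp : 0 < T / N := by positivity
  have : NeZero N := ⟨hN.ne'⟩
  have hsT := ofReal_sqrt_ne_zero hT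
  have hsN := ofReal_sqrt_ne_zero hN'
  have hsum : Summable fun n : ℤ =>
      midWindowed K T Tcp S (τ + n * (T / N)) * phase (-(n * ν * (T / N))) := by
    refine summable_of_hasFiniteSupport
      ((hasFiniteSupport_midWindowed K T Tcp S τ hp).subset fun n hn h => hn ?_)
    have h : midWindowed K T Tcp S (τ + n * (T / N)) = 0 := h
    simp only [h, zero_mul]
  -- Split `n = mN + r` with `0 ≤ r < N`: the shift `n * (T / N)` becomes `r * (T / N) + m * T`, and
  -- the multicarrier signal does not see `m * T`.
  rw [zak, ← (Int.divModEquiv N).symm.tsum_eq, ← (Equiv.prodComm (Fin N) ℤ).tsum_eq,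
    Summable.tsum_prod, tsum_fintype, Finset.mul_sum, Finset.sum_range, Finset.mul_sum]
  · refine Finset.sum_congr rfl fun r _ => ?_
    rw [← tsum_mul_left, ← tsum_mul_left, ← tsum_mul_left, ← tsum_mul_left]
    congr 1
    funext m
    simp only [Equiv.prodComm_apply, Prod.swap_prod_mk, Int.divModEquiv_symm_apply]
    have e1 : (((m * N + (r : ℕ) : ℤ) : ℝ) * (T / N)) = r * (T / N) + m * T := by
      push_cast
      field_simp
      ring
    have e2 : τ + T * (m + (r : ℕ) / N) = τ + (r * (T / N) + m * T) := by
      field_simp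
      ring
    have e3 : -(((m * N + (r : ℕ) : ℤ) : ℝ) * ν * (T / N)) = -(ν * (T * (m + (r : ℕ) / N))) := by
      push_cast
      field_simp
    rw [e3, e1, e2, midWindowed, ← add_assoc, multicarrier_add_int_mul K hT, Real.sqrt_div hT.le]
    push_cast
    field_simp
  · have h := (Int.divModEquiv N).symm.summable_iff.mpr hsum
    exact (Equiv.prodComm (Fin N) ℤ).summable_iff.mpr h

/-- The phases add up to `(ν - b)(τ - a) + (ν - b)a = (ν - b)τ`, which is free of `a`; this
decouples the sums over `k` and `l`. -/
theorem twistedConv_dirac_wtx (B T Tcp a b τ ν : ℝ) :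
    twistedConv (wtx B T Tcp) (Measure.dirac (a, b)) τ ν =
      w1 B T (τ - a) * (w2 T Tcp (ν - b) * phase ((ν - b) * τ)) := by
  rw [twistedConv, integral_dirac, wtx]
  have : phase ((ν - b) * τ) = phase ((ν - b) * (τ - a)) * phase ((ν - b) * a) := by
    rw [← phase_add]
    ring_nf
  rw [this]
  ring

/-- Filtering the quasi-periodic symbols with `w_tx` gives the Zak transform of the windowed
multicarrier signal. -/
theorem isFilteredDD_zak {M N : ℕ} (hM : 0 < M) (hN : 0 < N) {T Tcp : ℝ} (hT : 0 < T)
    (hTcp : 0 ≤ Tcp) (x : ℤ → ℤ → ℂ) :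
    IsFilteredDD ((M * N : ℕ) * (1 / T)) T (wtx ((M * N : ℕ) * (1 / T)) T Tcp) (xdd M N x)
      (zak (T / N) (midWindowed (M * N) T Tcp (idfzt M N (xdd M N x)))) := by
  have hM' : (0 : ℝ) < M := by exact_mod_cast hM
  have hN' : (0 : ℝ) < N := by exact_mod_cast hN
  intro τ ν
  rw [zak_midWindowed hN _ hT]
  have hA := fun r : ℕ => tendsto_sum_idft_mul_w1 (Nat.mul_pos hM hN) hT
    (idfzt M N (xdd M N x)) (r * M) τ
  have e : ∀ r : ℕ, τ + ((r * M : ℤ) : ℝ) / ((M * N : ℕ) * (1 / T)) = τ + r * (T / N) := by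
    intro r
    push_cast
    field_simp
  simp only [e] at hA
  have hB := fun r : ℕ => tendsto_sum_phase_mul_w2 hT hTcp (r / N) τ ν
  -- For each `r` one factor depends on `P` only and the other on `Q` only, so the product converges
  -- as both grow independently.
  have h := (tendsto_finsetSum (Finset.range N) fun r _ =>
    ((hA r).comp (tendsto_fst (f := atTop) (g := (atTop : Filter ℕ)))).mul
      ((hB r).comp (tendsto_snd (f := (atTop : Filter ℕ)) (g := atTop)))).const_mul
        (1 / (Real.sqrt N : ℂ))
  refine h.congr fun PQ => ?_
  simp only [Function.comp, twistedConv_dirac_wtx, Finset.sum_mul_sum]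
  rw [Finset.sum_comm, Finset.mul_sum]
  refine Finset.sum_congr rfl fun k _ => ?_
  rw [Finset.sum_comm, Finset.mul_sum]
  refine Finset.sum_congr rfl fun l _ => ?_
  rw [xdd_eq_sum_idft hM hN x k l, mul_assoc, Finset.sum_mul]
  congr 1
  refine Finset.sum_congr rfl fun r _ => ?_
  rw [div_mul_eq_mul_div]
  ring

/-- Given `B * T = M * N`, the two equations for `M` and `N` force `τp * νp = 1`. -/
theorem isZakPeriods_iff {M N : ℕ} {B T : ℝ} (hB : 0 < B) (hT : 0 < T) (hBT : B * T = M * N)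
    (τp νp : ℝ) : IsZakPeriods M N B T τp νp ↔ νp = N / T ∧ τp = M / B := by
  rw [IsZakPeriods, eq_div_iff hT.ne', eq_div_iff hB.ne']
  constructor
  · rintro ⟨-, h2, h3⟩
    exact ⟨by rw [h3]; ring, by rw [h2]; ring⟩
  · rintro ⟨h1, h2⟩
    refine ⟨?_, by rw [← h2]; ring, by rw [← h1]; ring⟩
    have : τp * νp * (B * T) = 1 * (B * T) := by
      linear_combination τp * B * h1 + (N : ℝ) * h2 - hBT
    exact mul_right_cancel₀ (mul_pos hB hT).ne' this

theorem isIdftCpOfdm_cpOfdm {K : ℕ} (hK : 0 < K) {T : ℝ} (hT : 0 < T) (W : ℝ → ℂ) (S : ℤ → ℂ) :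
    IsIdftCpOfdm K (K * (1 / T)) T (w1 (K * (1 / T)) T) W S (cpOfdm K (1 / T) W S) := by
  refine ⟨multicarrier K (1 / T) S, fun t => ?_, fun t => mul_comm _ _⟩
  have h := (tendsto_sum_idft_mul_w1 hK hT S 0 t).const_mul (Real.sqrt T : ℂ)
  rw [← mul_assoc, mul_one_div_cancel (ofReal_sqrt_ne_zero hT), one_mul, Int.cast_zero, zero_div,
    add_zero] at h
  simpa only [linConv, integral_dirac, add_zero] using h

end ZakOtfs

theorem theorem1 (K M N : ℕ) (hM : 0 < M) (hN : 0 < N) (hK : M * N = K)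
    (T Tcp Δf B : ℝ) (hT : 0 < T) (hTcp : 0 ≤ Tcp) (hΔf : Δf = 1 / T) (hB : B = (K : ℝ) * Δf) :
    -- `w₁` is band-limited to an interval of length `B`
    (∀ t : ℝ, ZakOtfs.w1 B T t =
      ∫ f in (-(Δf / 2))..(B - Δf / 2), (1 / (Real.sqrt B : ℂ)) * ZakOtfs.phase (f * t)) ∧
    -- `w₂` is the Fourier transform of the rectangular window
    (∀ ν : ℝ, ZakOtfs.w2 T Tcp ν =
      ∫ t : ℝ, ZakOtfs.window T Tcp t * ZakOtfs.phase (-(ν * t))) ∧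
    -- the delay and Doppler periods
    (∀ τp νp : ℝ, ZakOtfs.IsZakPeriods M N B T τp νp ↔
      (νp = (N : ℝ) / T ∧ τp = (M : ℝ) / B)) ∧
    (N : ℝ) / T = (N : ℝ) * Δf ∧ (M : ℝ) / B = 1 / ((N : ℝ) / T) ∧
    -- the precoded CP-OFDM signal is the Zak-OTFS signal with filter `w_tx`
    ∀ x : ℤ → ℤ → ℂ,
      ZakOtfs.IsIdftCpOfdm K B T (ZakOtfs.w1 B T) (ZakOtfs.window T Tcp)
        (ZakOtfs.idfzt M N (ZakOtfs.xdd M N x))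
        (ZakOtfs.cpOfdm K Δf (ZakOtfs.window T Tcp) (ZakOtfs.idfzt M N (ZakOtfs.xdd M N x))) ∧
      ∃ X : ℝ → ℂ,
        ZakOtfs.IsZakOtfs M N B T ((M : ℝ) / B) ((N : ℝ) / T) (ZakOtfs.wtx B T Tcp) x X ∧
        ∀ t : ℝ, t ≠ -Tcp → t ≠ T →
          X t = ZakOtfs.cpOfdm K Δf (ZakOtfs.window T Tcp)
            (ZakOtfs.idfzt M N (ZakOtfs.xdd M N x)) t := by
  subst hΔf hB hK
  have hM' : (0 : ℝ) < M := by exact_mod_cast hM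
  have hN' : (0 : ℝ) < N := by exact_mod_cast hN
  have hB : (0 : ℝ) < (M * N : ℕ) * (1 / T) := by
    push_cast
    positivity
  have hBT : ((M * N : ℕ) * (1 / T) : ℝ) * T = M * N := by
    push_cast
    field_simp
  have hp : (M : ℝ) / ((M * N : ℕ) * (1 / T)) = T / N := by
    push_cast
    field_simp
  have hp0 : 0 < T / N := by positivity
  have hpq : T / N * (N / T) = 1 := by field_simp
  have hper := ZakOtfs.isZakPeriods_iff hB hT hBT
  refine ⟨ZakOtfs.w1_eq_integral hB T, ZakOtfs.w2_eq_integral hT hTcp, hper, by ring,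
    by rw [hp, one_div_div], fun x => ⟨ZakOtfs.isIdftCpOfdm_cpOfdm (Nat.mul_pos hM hN) hT _ _, ?_⟩⟩
  have hsupp := fun t => ZakOtfs.hasFiniteSupport_midWindowed (M * N) T Tcp
    (ZakOtfs.idfzt M N (ZakOtfs.xdd M N x)) t hp0
  -- The Zak-OTFS signal takes the mean window value at the two jumps, whereas `window` is
  -- right-continuous there; elsewhere they agree.
  refine ⟨ZakOtfs.midWindowed (M * N) T Tcp (ZakOtfs.idfzt M N (ZakOtfs.xdd M N x)),
    ⟨(hper _ _).mpr ⟨rfl, rfl⟩, _, ZakOtfs.isFilteredDD_zak hM hN hT hTcp x, ?_, ?_, ?_⟩, ?_⟩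
  · rw [hp]
    exact ZakOtfs.isQuasiPeriodic_zak hpq _
  · exact fun t => ZakOtfs.intervalIntegrable_zak _ _ t (hsupp t) _ _
  · intro t
    rw [hp, ZakOtfs.invZak_zak hp0 hpq _ t (hsupp t)]
  · intro t h1 h2
    rw [ZakOtfs.midWindowed, ZakOtfs.boxcar_div_sqrt_eq_window hT hTcp h1 h2, mul_comm]
    rfl
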